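/- All graphs are finite and may have loops and parallel edges. A \emph{biased graph} $(G,\mathcal B)$ is a graph $G$ with a set $\mathcal B$ of cycles of $G$ (called balanced) such that no theta subgraph of $G$ (two distinct vertices joined by three internally disjoint paths) contains exactly two cycles of $\mathcal B$. For a group $\Gamma$, an orientation of $G$ and a map $\phi:E(G)\to\Gamma$, let $\phi(W)$, for a walk $W$, be the product in order of the labels of its edges, inverted at the edges traversed backward, and let $\mathcal B_\phi$ be the set of cycles $C$ such that some simple closed walk $W$ around $C$ satisfies $\phi(W)=1$; the biased graph $(G,\mathcal B_\phi)$ is called \emph{$\Gamma$-labelled}. \emph{Deleting} an edge $e$ from $(G,\mathcal B)$ deletes $e$ from $G$ and removes from $\mathcal B$ every cycle containing $e$. \emph{Contracting} a balanced loop means deleting it. Contracting a non-loop edge $e$ contracts $e$ in $G$ and declares a cycle $C$ of $G/e$ balanced if $C\in\mathcal B$ or $E(C)\cup\{e\}$ is the edge set of a cycle in $\mathcal B$. For unbalanced loops $e$, with end $v$, fix one of three conventions: (i) they may not be contracted; (ii) (lift) contracting $e$ deletes $e$ and makes all cycles balanced; (iii) (frame) contracting $e$ deletes $e$, replaces each edge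 joining $v$ to another vertex $x$ by an unbalanced loop at $x$, and makes every other loop at $v$ balanced, all other cycles keeping their status. A \emph{minor} of $(G,\mathcal B)$ is a biased graph obtained by a finite sequence of deletions and contractions. An \emph{antichain} is a set of biased graphs no one of which is isomorphic to a minor of another. \textbf{Theorem.} Let $\Gamma$ be a group and let $t\ge 3$ be an integer. Under each of the three conventions, there exists an infinite antichain of $\Gamma$-labelled biased graphs, each on exactly $t$ vertices, if and only if $\Gamma$ is infinite. -/

import Mathlib

open scoped Graph

namespace Graph

variable {α β : Type*}

/-- `G.IsWalk x w y`: `w` is a walk of the multigraph `G` from `x` to `y`. The walk is recorded as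
the list of its steps `(e, z)`, where `e` is the edge traversed and `z` is the vertex reached. -/
inductive IsWalk (G : Graph α β) : α → List (β × α) → α → Prop
  | nil {x : α} (hx : x ∈ V(G)) : IsWalk G x [] x
  | cons {e : β} {x y z : α} {w : List (β × α)} (h : G.IsLink e x y) (hw : IsWalk G y w z) :
      IsWalk G x ((e, y) :: w) z

/-- A path: a walk that repeats no vertex. -/
def IsPath (G : Graph α β) (x : α) (w : List (β × α)) (y : α) : Prop :=
  G.IsWalk x w y ∧ (x :: w.map Prod.snd).Nodup

/-- A simple closed walk: a nonempty closed walk that repeats no edge, and repeats no vertex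
except that its last vertex is its first one. (A loop gives one of length 1, a pair of parallel
edges gives one of length 2.) -/
def IsSimpleClosedWalk (G : Graph α β) (x : α) (w : List (β × α)) : Prop :=
  G.IsWalk x w x ∧ w ≠ [] ∧ (w.map Prod.snd).Nodup ∧ (w.map Prod.fst).Nodup

/-- The set of edges of a walk. -/
def walkEdges (w : List (β × α)) : Set β := {e | e ∈ w.map Prod.fst}

/-- The internal vertices of a path given by its list of steps. -/
def walkInterior (w : List (β × α)) : List α := (w.map Prod.snd).dropLast

/-- `C` is (the edge set of) a cycle of `G`. Cycles are identified with their edge sets. -/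
def IsCycle (G : Graph α β) (C : Set β) : Prop :=
  ∃ x w, G.IsSimpleClosedWalk x w ∧ walkEdges w = C

/-- `A`, `B`, `C` are the edge sets of the three internally disjoint paths, joining two distinct
vertices, of a theta subgraph of `G`. Its three cycles are `A ∪ B`, `B ∪ C` and `A ∪ C`. -/
def IsTheta (G : Graph α β) (A B C : Set β) : Prop :=
  ∃ (x y : α) (p q r : List (β × α)), x ≠ y ∧
    G.IsPath x p y ∧ G.IsPath x q y ∧ G.IsPath x r y ∧
    (walkInterior p).Disjoint (walkInterior q) ∧
    (walkInterior q).Disjoint (walkInterior r) ∧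
    (walkInterior p).Disjoint (walkInterior r) ∧
    walkEdges p = A ∧ walkEdges q = B ∧ walkEdges r = C ∧
    Disjoint A B ∧ Disjoint B C ∧ Disjoint A C

open Classical in
/-- Contraction of the non-loop edge `e` with ends `x` and `y`: the edge `e` is removed and
the vertex `y` is identified with `x`. -/
noncomputable def contractLink (G : Graph α β) (e : β) (x y : α) : Graph α β :=
  (G.deleteEdges {e}).map (fun v => if v = y then x else v)

end Graph

/-- A (finite) biased graph with vertices in `α` and edges in `β`: a finite multigraph with
a set of cycles, called balanced, such that no theta subgraph has exactly two balanced cycles. -/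
structure BiasedGraph (α β : Type*) where
  graph : Graph α β
  finite_vertexSet : V(graph).Finite
  finite_edgeSet : E(graph).Finite
  /-- The edge sets of the balanced cycles. -/
  balanced : Set (Set β)
  isCycle_of_balanced : ∀ C ∈ balanced, graph.IsCycle C
  /-- The three paths of a theta may be permuted, so this excludes exactly two balanced cycles. -/
  theta : ∀ A B C : Set β, graph.IsTheta A B C →
    A ∪ B ∈ balanced → B ∪ C ∈ balanced → A ∪ C ∈ balanced

/-- A group labelling of `G`: an orientation of the edges together with a map to the group.
Values outside the edge set of `G` are irrelevant. -/
structure GroupLabelling (Γ : Type*) {α β : Type*} (G : Graph α β) where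
  tail : β → α
  head : β → α
  isLink : ∀ e ∈ E(G), G.IsLink e (tail e) (head e)
  label : β → Γ

namespace GroupLabelling

variable {Γ : Type*} [Group Γ] {α β : Type*} {G : Graph α β}

/-- `φ.HasGain x w y g`: the walk `w` from `x` to `y` can be traversed so that the product of its
labels, inverted at edges traversed backward, is `g`. (The direction in which `w` traverses an
edge is determined by `w`, except for a loop, which may be traversed either way.) -/
inductive HasGain (φ : GroupLabelling Γ G) : α → List (β × α) → α → Γ → Prop
  | nil {x : α} (hx : x ∈ V(G)) : HasGain φ x [] x 1
  | forward {e : β} {x y z : α} {w : List (β × α)} {g : Γ} (he : e ∈ E(G))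
      (hx : φ.tail e = x) (hy : φ.head e = y) (hw : HasGain φ y w z g) :
      HasGain φ x ((e, y) :: w) z (φ.label e * g)
  | backward {e : β} {x y z : α} {w : List (β × α)} {g : Γ} (he : e ∈ E(G))
      (hx : φ.head e = x) (hy : φ.tail e = y) (hw : HasGain φ y w z g) :
      HasGain φ x ((e, y) :: w) z ((φ.label e)⁻¹ * g)

/-- The cycles around which some simple closed walk has gain `1`. -/
def balancedCycles (φ : GroupLabelling Γ G) : Set (Set β) :=
  {C | ∃ x w, G.IsSimpleClosedWalk x w ∧ Graph.walkEdges w = C ∧ φ.HasGain x w x 1}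

end GroupLabelling

/-- The conventions for contracting an unbalanced loop: not allowed, as in the lift matroid, or
as in the frame matroid. -/
inductive LoopContraction
  | forbidden
  | lift
  | frame

namespace BiasedGraph

variable {α β : Type*}

/-- `Ω` is the biased graph of some `Γ`-labelling of its underlying graph. -/
def IsLabellable (Γ : Type*) [Group Γ] (Ω : BiasedGraph α β) : Prop :=
  ∃ φ : GroupLabelling Γ Ω.graph, φ.balancedCycles = Ω.balanced

/-- `Ω'` is obtained from `Ω` by deleting `e`. -/
def IsDeletion (Ω : BiasedGraph α β) (e : β) (Ω' : BiasedGraph α β) : Prop :=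
  Ω'.graph = Ω.graph.deleteEdges {e} ∧ Ω'.balanced = {C ∈ Ω.balanced | e ∉ C}

/-- `Ω'` is obtained from `Ω` by contracting the edge `e` with ends `x` and `y`
(to be used when `x ≠ y`). -/
def IsLinkContraction (Ω : BiasedGraph α β) (e : β) (x y : α) (Ω' : BiasedGraph α β) : Prop :=
  Ω'.graph = Ω.graph.contractLink e x y ∧
  Ω'.balanced = {C | Ω'.graph.IsCycle C ∧ (C ∈ Ω.balanced ∨ insert e C ∈ Ω.balanced)}

/-- `Ω'` is obtained from `Ω` by contracting, as in the lift matroid, the unbalanced loop `e`: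
delete `e` and declare every cycle balanced. -/
def IsLiftLoopContraction (Ω : BiasedGraph α β) (e : β) (Ω' : BiasedGraph α β) : Prop :=
  Ω'.graph = Ω.graph.deleteEdges {e} ∧ Ω'.balanced = {C | Ω'.graph.IsCycle C}

/-- `Ω'` is obtained from `Ω` by contracting, as in the frame matroid, the unbalanced loop `e`
at `v`: delete `e`, turn every edge joining `v` to another vertex `x` into an unbalanced loop
at `x`, and make every other loop at `v` balanced. -/
def IsFrameLoopContraction (Ω : BiasedGraph α β) (e : β) (v : α) (Ω' : BiasedGraph α β) : Prop :=
  V(Ω'.graph) = V(Ω.graph) ∧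
  (∀ f x y, Ω'.graph.IsLink f x y ↔ f ≠ e ∧
    ((Ω.graph.IsLink f x y ∧ x ≠ v ∧ y ≠ v) ∨
      (Ω.graph.IsLink f v x ∧ x ≠ v ∧ x = y) ∨
      (Ω.graph.IsLoopAt f v ∧ x = v ∧ y = v))) ∧
  Ω'.balanced = {C | Ω'.graph.IsCycle C ∧
    (C ∈ Ω.balanced ∨ ∃ f, Ω.graph.IsLoopAt f v ∧ C = {f})}

/-- `Ω'` is obtained from `Ω` by deleting or contracting one edge, where `κ` is the convention for
the contraction of unbalanced loops. -/
inductive MinorStep (κ : LoopContraction) (Ω Ω' : BiasedGraph α β) : Prop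
  | delete (e : β) (he : e ∈ E(Ω.graph)) (h : Ω.IsDeletion e Ω')
  | contractBalancedLoop (e : β) (he : {e} ∈ Ω.balanced) (h : Ω.IsDeletion e Ω')
  | contractLink (e : β) (x y : α) (he : Ω.graph.IsLink e x y) (hxy : x ≠ y)
      (h : Ω.IsLinkContraction e x y Ω')
  | liftContract (hκ : κ = .lift) (e : β) (v : α) (he : Ω.graph.IsLoopAt e v)
      (hu : {e} ∉ Ω.balanced) (h : Ω.IsLiftLoopContraction e Ω')
  | frameContract (hκ : κ = .frame) (e : β) (v : α) (he : Ω.graph.IsLoopAt e v)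
      (hu : {e} ∉ Ω.balanced) (h : Ω.IsFrameLoopContraction e v Ω')

/-- `Ω'` is a minor of `Ω`: it is formed by a finite sequence of deletions and contractions. -/
def IsMinor (κ : LoopContraction) (Ω' Ω : BiasedGraph α β) : Prop :=
  Relation.ReflTransGen (MinorStep κ) Ω Ω'

/-- Isomorphism of biased graphs. -/
def IsIsomorphic (Ω Ω' : BiasedGraph α β) : Prop :=
  ∃ (f : α → α) (g : β → β),
    Set.BijOn f V(Ω.graph) V(Ω'.graph) ∧ Set.BijOn g E(Ω.graph) E(Ω'.graph) ∧
    (∀ e ∈ E(Ω.graph), ∀ x ∈ V(Ω.graph), ∀ y ∈ V(Ω.graph),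
      Ω.graph.IsLink e x y ↔ Ω'.graph.IsLink (g e) (f x) (f y)) ∧
    ∀ C ⊆ E(Ω.graph), C ∈ Ω.balanced ↔ g '' C ∈ Ω'.balanced

/-- `Ω'` is dominated by `Ω`: it is isomorphic to a minor of `Ω`. -/
def IsDominated (κ : LoopContraction) (Ω' Ω : BiasedGraph α β) : Prop :=
  ∃ Ω'' : BiasedGraph α β, IsMinor κ Ω'' Ω ∧ Ω'.IsIsomorphic Ω''

end BiasedGraph

/-! Over a finite group, a labelled graph on `t` vertices has only finitely many possible edge types
(indices of tail and head, and label). By Dickson's lemma, any infinite sequence of such graphs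
contains an earlier one with at most as many edges of each type as a later one. Matching edges type
by type embeds the earlier labelled graph in the later one, and deleting the unmatched edges shows
domination (`isDominated_of_profile_le`). Only deletions occur, so the loop convention plays no
role.

Over an infinite group, take a triangle with many parallel edges on each side, and the remaining `t
- 3` vertices isolated. Choose `a i` and `b j` so that the products `a i * b j` determine `i` and
`j` (`exists_products_injective`), and use them as labels on two sides. An edge on the third side
with label `(a i * b j)⁻¹` then lies in exactly one balanced triangle. The third side follows a
cycle of length `2 * n` in the complete bipartite graph of pairs `(i, j)`, so the balanced cycles
form a ring of `2 * n` triangles in which exactly the consecutive ones meet.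

These graphs have no loops, and contracting a link loses a vertex. A minor with `t` vertices is
therefore obtained by deletions alone and gains no balanced cycle (`IsMinor.balanced_subset`),
whatever the convention. Domination thus maps one ring injectively into another, preserving
adjacency. A cycle embeds in this way only in a cycle of its own length (`le_of_cycle_embedding`),
so distinct values of `n` give incomparable graphs. -/

/-! ### Transport of walks and gains along maps -/

namespace Graph

variable {α β : Type*} {G H : Graph α β}

lemma IsWalk.vertex_mem {x y : α} {w : List (β × α)} (h : G.IsWalk x w y) :
    ∀ v ∈ w.map Prod.snd, v ∈ V(G) := by
  induction h with
  | nil hx => simp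
  | cons h hw ih =>
    intro v hv
    rcases List.mem_cons.1 hv with rfl | hv
    · exact h.right_mem
    · exact ih v hv

/-- A map that preserves the links of a walk takes it to a walk. -/
lemma IsWalk.map {α' β' : Type*} {H : Graph α' β'} {f : α → α'} {g : β → β'}
    {x y : α} {w : List (β × α)}
    (h : G.IsWalk x w y) (hf : Set.MapsTo f V(G) V(H))
    (hfg : ∀ e ∈ walkEdges w, ∀ x y, G.IsLink e x y → H.IsLink (g e) (f x) (f y)) :
    H.IsWalk (f x) (w.map (Prod.map g f)) (f y) := by
  induction h with
  | nil hx => exact .nil (hf hx)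
  | cons h hw ih =>
    exact .cons (hfg _ (by simp [walkEdges]) _ _ h)
      (ih fun e he => hfg e (by simp only [walkEdges, Set.mem_ofPred_eq] at he ⊢; simp [he]))

lemma IsWalk.mono {x y : α} {w : List (β × α)} (h : G.IsWalk x w y) (hV : V(G) ⊆ V(H))
    (hE : ∀ e ∈ walkEdges w, ∀ x y, G.IsLink e x y → H.IsLink e x y) : H.IsWalk x w y := by
  simpa using h.map (f := id) (g := id) hV hE

lemma IsWalk.of_deleteEdges {D : Set β} {x y : α} {w : List (β × α)}
    (h : (G.deleteEdges D).IsWalk x w y) : G.IsWalk x w y :=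
  h.mono subset_rfl fun _ _ _ _ h => h.1

lemma IsPath.of_deleteEdges {D : Set β} {x y : α} {w : List (β × α)}
    (h : (G.deleteEdges D).IsPath x w y) : G.IsPath x w y :=
  ⟨h.1.of_deleteEdges, h.2⟩

lemma IsTheta.of_deleteEdges {D A B C : Set β} (h : (G.deleteEdges D).IsTheta A B C) :
    G.IsTheta A B C := by
  obtain ⟨x, y, p, q, r, hxy, hp, hq, hr, h⟩ := h
  exact ⟨x, y, p, q, r, hxy, hp.of_deleteEdges, hq.of_deleteEdges, hr.of_deleteEdges, h⟩

lemma IsCycle.deleteEdges {D C : Set β} (h : G.IsCycle C) (hD : Disjoint C D) :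
    (G.deleteEdges D).IsCycle C := by
  obtain ⟨x, w, ⟨hw, h⟩, rfl⟩ := h
  refine ⟨x, w, ⟨hw.mono subset_rfl fun e he x y h => ?_, h⟩, rfl⟩
  exact ⟨h, Set.disjoint_left.1 hD he⟩

end Graph

namespace GroupLabelling

variable {Γ : Type*} [Group Γ] {α β α' β' : Type*} {G : Graph α β} {H : Graph α' β'}

lemma HasGain.map {φ : GroupLabelling Γ G} {ψ : GroupLabelling Γ H} {f : α → α'} {g : β → β'}
    {x y : α} {w : List (β × α)} {a : Γ} (h : φ.HasGain x w y a) (hf : Set.MapsTo f V(G) V(H))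
    (hg : ∀ e ∈ Graph.walkEdges w, g e ∈ E(H) ∧ ψ.tail (g e) = f (φ.tail e) ∧
      ψ.head (g e) = f (φ.head e) ∧ ψ.label (g e) = φ.label e) :
    ψ.HasGain (f x) (w.map (Prod.map g f)) (f y) a := by
  induction h with
  | nil hx => exact .nil (hf hx)
  | @forward e x y z w a he hx hy hw ih =>
    obtain ⟨h1, h2, h3, h4⟩ := hg e (by simp [Graph.walkEdges])
    rw [← h4]
    refine .forward h1 (h2.trans (congrArg f hx)) (h3.trans (congrArg f hy)) (ih fun e he => hg e ?_)
    simp only [Graph.walkEdges, Set.mem_ofPred_eq] at he ⊢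
    simp [he]
  | @backward e x y z w a he hx hy hw ih =>
    obtain ⟨h1, h2, h3, h4⟩ := hg e (by simp [Graph.walkEdges])
    rw [← h4]
    refine .backward h1 (h3.trans (congrArg f hx)) (h2.trans (congrArg f hy))
      (ih fun e he => hg e ?_)
    simp only [Graph.walkEdges, Set.mem_ofPred_eq] at he ⊢
    simp [he]

/-- Balanced cycles are preserved by label-preserving maps that are injective on vertices and on
the edges of the cycle. -/
lemma image_mem_balancedCycles {φ : GroupLabelling Γ G} {ψ : GroupLabelling Γ H} {f : α → α'}
    {g : β → β'} {F C : Set β} (hf : Set.MapsTo f V(G) V(H))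
    (hfi : Set.InjOn f V(G)) (hgi : Set.InjOn g F)
    (hg : ∀ e ∈ F, g e ∈ E(H) ∧ ψ.tail (g e) = f (φ.tail e) ∧
      ψ.head (g e) = f (φ.head e) ∧ ψ.label (g e) = φ.label e)
    (hC : C ∈ φ.balancedCycles) (hCF : C ⊆ F) : g '' C ∈ ψ.balancedCycles := by
  obtain ⟨x, w, ⟨hw, hne, hs, he⟩, rfl, hgain⟩ := hC
  refine ⟨f x, w.map (Prod.map g f), ⟨hw.map hf ?_, by simpa using hne, ?_, ?_⟩, ?_,
    hgain.map hf fun e he => hg e (hCF he)⟩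
  · intro e hew x y hxy
    obtain ⟨h1, h2, h3, -⟩ := hg e (hCF hew)
    have := ψ.isLink _ h1
    rw [h2, h3] at this
    rcases (φ.isLink e hxy.edge_mem).eq_and_eq_or_eq_and_eq hxy with ⟨hx, hy⟩ | ⟨hx, hy⟩
    · rwa [← hx, ← hy]
    · rw [← hx, ← hy]
      exact this.symm
  · have : (w.map (Prod.map g f)).map Prod.snd = (w.map Prod.snd).map f := by simp
    rw [this]
    exact hs.map_on fun x hx y hy h => hfi (hw.vertex_mem x hx) (hw.vertex_mem y hy) h
  · have : (w.map (Prod.map g f)).map Prod.fst = (w.map Prod.fst).map g := by simp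
    rw [this]
    exact he.map_on fun x hx y hy h => hgi (hCF hx) (hCF hy) h
  · ext e
    simp [Graph.walkEdges]

end GroupLabelling

/-! ### Finite groups: domination by counting edges -/

namespace BiasedGraph

variable {α β : Type*}

/-- Deletion of a set of edges from a biased graph. -/
def deleteEdges (Ω : BiasedGraph α β) (D : Set β) : BiasedGraph α β where
  graph := Ω.graph.deleteEdges D
  finite_vertexSet := Ω.finite_vertexSet
  finite_edgeSet := Ω.finite_edgeSet.subset Set.sdiff_subset
  balanced := {C ∈ Ω.balanced | Disjoint C D}
  isCycle_of_balanced C hC := (Ω.isCycle_of_balanced C hC.1).deleteEdges hC.2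
  theta A B C h hAB hBC := by
    refine ⟨Ω.theta A B C h.of_deleteEdges hAB.1 hBC.1, ?_⟩
    exact Disjoint.sup_left (hAB.2.mono_left le_sup_left) (hBC.2.mono_left le_sup_right)

lemma deleteEdges_isMinor (κ : LoopContraction) (Ω : BiasedGraph α β) {D : Set β}
    (hD : D ⊆ E(Ω.graph)) : IsMinor κ (Ω.deleteEdges D) Ω := by
  have hfin := Ω.finite_edgeSet.subset hD
  induction D, hfin using Set.Finite.induction_on with
  | empty =>
    have : Ω.deleteEdges ∅ = Ω := by
      cases Ω
      simp [deleteEdges]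
    rw [this]
    exact Relation.ReflTransGen.refl
  | @insert e D he _ ih =>
    refine (ih ((Set.subset_insert _ _).trans hD)).tail
      (.delete e ⟨hD (Set.mem_insert _ _), he⟩ ⟨?_, ?_⟩)
    · simp only [deleteEdges, Graph.deleteEdges_deleteEdges]
      congr 1
      exact (Set.union_singleton).symm
    · ext C
      simp only [deleteEdges, Set.disjoint_insert_right, Set.mem_ofPred_eq]
      tauto

/-- The number of edges of each type, the type of an edge consisting of the indices of its tail
and head and of its label. -/
noncomputable def profile {Γ : Type*} {t : ℕ} (Ω : BiasedGraph α β)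
    (φ : GroupLabelling Γ Ω.graph) (ν : α → Fin t) : Fin t × Fin t × Γ → ℕ :=
  fun k => {e ∈ E(Ω.graph) | (ν (φ.tail e), ν (φ.head e), φ.label e) = k}.ncard

end BiasedGraph

/-- If each colour is at most as frequent in `T` as in `T'`, there is a colour-preserving injection
from `T` to `T'`. -/
lemma exists_injOn_of_ncard_fiber_le {β K : Type*} {T T' : Set β} (hT : T.Finite) (hT' : T'.Finite)
    (τ τ' : β → K) (h : ∀ k, {e ∈ T | τ e = k}.ncard ≤ {e ∈ T' | τ' e = k}.ncard) :
    ∃ g : β → β, Set.InjOn g T ∧ ∀ e ∈ T, g e ∈ T' ∧ τ' (g e) = τ e := by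
  rcases isEmpty_or_nonempty β with hβ | hβ
  · exact ⟨id, fun x => hβ.elim x, fun x => hβ.elim x⟩
  have key : ∀ k, ∃ g : β → β, {e ∈ T | τ e = k} ⊆ g ⁻¹' {e ∈ T' | τ' e = k} ∧
      Set.InjOn g {e ∈ T | τ e = k} := by
    intro k
    have h1 : {e ∈ T | τ e = k}.Finite := hT.subset (Set.sep_subset _ _)
    have h2 : {e ∈ T' | τ' e = k}.Finite := hT'.subset (Set.sep_subset _ _)
    refine h1.exists_injOn_of_encard_le ?_
    rw [← h1.cast_ncard_eq, ← h2.cast_ncard_eq]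
    exact_mod_cast h k
  choose g hg hgi using key
  have hmem : ∀ e ∈ T, g (τ e) e ∈ T' ∧ τ' (g (τ e) e) = τ e := fun e he => hg (τ e) ⟨he, rfl⟩
  -- The injections chosen for the separate colours glue together, because the colour of an image
  -- recovers the colour of its source.
  refine ⟨fun e => g (τ e) e, fun x hx y hy hxy => ?_, hmem⟩
  have hc : τ x = τ y := by
    rw [← (hmem x hx).2, ← (hmem y hy).2]
    exact congrArg τ' hxy
  refine hgi (τ x) ⟨hx, rfl⟩ ⟨hy, hc.symm⟩ ?_
  simpa only [hc] using hxy

namespace BiasedGraph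

variable {α β : Type*} {Γ : Type*} [Group Γ]

/-- Vertices are matched by their indices and edges by a type-preserving injection. Gains are then
preserved, so the labelled graph is a copy of the subgraph left after deleting the edges outside the
image. -/
lemma isDominated_of_profile_le (κ : LoopContraction) {t : ℕ} [NeZero t] {Ω Ω' : BiasedGraph α β}
    {φ : GroupLabelling Γ Ω.graph} {φ' : GroupLabelling Γ Ω'.graph}
    (hφ : φ.balancedCycles = Ω.balanced) (hφ' : φ'.balancedCycles = Ω'.balanced)
    {ν ν' : α → Fin t} (hν : Set.BijOn ν V(Ω.graph) Set.univ)
    (hν' : Set.BijOn ν' V(Ω'.graph) Set.univ) (hle : Ω.profile φ ν ≤ Ω'.profile φ' ν') :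
    Ω.IsDominated κ Ω' := by
  obtain ⟨g, hgi, hg⟩ := exists_injOn_of_ncard_fiber_le Ω.finite_edgeSet Ω'.finite_edgeSet
    (fun e => (ν (φ.tail e), ν (φ.head e), φ.label e))
    (fun e => (ν' (φ'.tail e), ν' (φ'.head e), φ'.label e)) hle
  have : Nonempty α := ⟨(hν.surjOn (Set.mem_univ 0)).choose⟩
  set f : α → α := fun v => Function.invFunOn ν' V(Ω'.graph) (ν v)
  have hfV : ∀ v, f v ∈ V(Ω'.graph) ∧ ν' (f v) = ν v := fun v =>
    Function.invFunOn_pos (hν'.surjOn (Set.mem_univ (ν v)))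
  have hfeq : ∀ v, ∀ v' ∈ V(Ω'.graph), ν' v' = ν v → v' = f v := fun v v' hv' h =>
    hν'.injOn hv' (hfV v).1 (h.trans (hfV v).2.symm)
  have hfbij : Set.BijOn f V(Ω.graph) V(Ω'.graph) := by
    refine ⟨fun v _ => (hfV v).1, fun x hx y hy hxy => hν.injOn hx hy ?_, fun v' hv' => ?_⟩
    · rw [← (hfV x).2, ← (hfV y).2, hxy]
    · obtain ⟨v, hv, h⟩ := hν.surjOn (Set.mem_univ (ν' v'))
      exact ⟨v, hv, (hfeq v v' hv' h.symm).symm⟩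
  have hgE : ∀ e ∈ E(Ω.graph), g e ∈ E(Ω'.graph) ∧ φ'.tail (g e) = f (φ.tail e) ∧
      φ'.head (g e) = f (φ.head e) ∧ φ'.label (g e) = φ.label e := by
    intro e he
    obtain ⟨h1, h2⟩ := hg e he
    simp only [Prod.mk.injEq] at h2
    have h3 := φ'.isLink _ h1
    exact ⟨h1, hfeq _ _ h3.left_mem h2.1, hfeq _ _ h3.right_mem h2.2.1, h2.2.2⟩
  have himg : E((Ω'.deleteEdges (E(Ω'.graph) \ g '' E(Ω.graph))).graph) = g '' E(Ω.graph) := by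
    have : g '' E(Ω.graph) ⊆ E(Ω'.graph) := by
      rintro _ ⟨e, he, rfl⟩
      exact (hgE e he).1
    simp [deleteEdges, Set.inter_eq_right.2 this]
  refine ⟨Ω'.deleteEdges (E(Ω'.graph) \ g '' E(Ω.graph)),
    Ω'.deleteEdges_isMinor κ Set.sdiff_subset, f, g, hfbij, ?_, ?_, ?_⟩
  · rw [himg]
    exact hgi.bijOn_image
  · intro e he x hx y hy
    obtain ⟨h1, h2, h3, -⟩ := hgE e he
    have hl := φ.isLink e he
    have hl' := φ'.isLink _ h1
    rw [h2, h3] at hl'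
    have hd : g e ∉ E(Ω'.graph) \ g '' E(Ω.graph) := fun h => h.2 ⟨e, he, rfl⟩
    have : (Ω'.deleteEdges (E(Ω'.graph) \ g '' E(Ω.graph))).graph.IsLink (g e) (f x) (f y) ↔
        Ω'.graph.IsLink (g e) (f x) (f y) :=
      ⟨fun h => h.1, fun h => ⟨h, hd⟩⟩
    rw [this, hl.isLink_iff, hl'.isLink_iff, hfbij.injOn.eq_iff hl.left_mem hx,
      hfbij.injOn.eq_iff hl.left_mem hy, hfbij.injOn.eq_iff hl.right_mem hx,
      hfbij.injOn.eq_iff hl.right_mem hy]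
  · intro C hC
    have hd : Disjoint (g '' C) (E(Ω'.graph) \ g '' E(Ω.graph)) :=
      Set.disjoint_left.2 fun e he h => h.2 (Set.image_mono hC he)
    have : g '' C ∈ (Ω'.deleteEdges (E(Ω'.graph) \ g '' E(Ω.graph))).balanced ↔
        g '' C ∈ Ω'.balanced := ⟨fun h => h.1, fun h => ⟨h, hd⟩⟩
    rw [this, ← hφ, ← hφ']
    refine ⟨fun h => GroupLabelling.image_mem_balancedCycles hfbij.mapsTo hfbij.injOn hgi
      hgE h hC, fun h => ?_⟩
    -- The empty set is never a cycle; a nonempty `C` supplies the inhabitant of `β` that the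
    -- inverse of `g` requires.
    rcases C.eq_empty_or_nonempty with rfl | ⟨e₀, -⟩
    · obtain ⟨x, w, ⟨-, hne, -⟩, hw, -⟩ := h
      rcases w with - | ⟨⟨e, y⟩, w⟩
      · exact (hne rfl).elim
      · have : e ∈ g '' ∅ := hw ▸ (by simp [Graph.walkEdges] : e ∈ Graph.walkEdges ((e, y) :: w))
        simp at this
    have : Nonempty β := ⟨e₀⟩
    have hinv := hgi.leftInvOn_invFunOn
    have hfinv := hfbij.injOn.leftInvOn_invFunOn
    have hback := GroupLabelling.image_mem_balancedCycles (φ := φ') (ψ := φ)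
      (f := Function.invFunOn f V(Ω.graph)) (g := Function.invFunOn g E(Ω.graph))
      (F := g '' E(Ω.graph)) ?_ ?_ ?_ ?_ h (Set.image_mono hC)
    · rwa [(hinv.mono hC).image_image] at hback
    · exact hfbij.surjOn.mapsTo_invFunOn
    · exact hfbij.surjOn.rightInvOn_invFunOn.injOn
    · rintro _ ⟨x, hx, rfl⟩ _ ⟨y, hy, rfl⟩ hxy
      rw [hinv hx, hinv hy] at hxy
      rw [hxy]
    · rintro _ ⟨e, he, rfl⟩
      obtain ⟨h1, h2, h3, h4⟩ := hgE e he
      have hl := φ.isLink e he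
      rw [hinv he, h2, h3, h4, hfinv hl.left_mem, hfinv hl.right_mem]
      exact ⟨he, rfl, rfl, rfl⟩

/-- Over a finite group, biased graphs with a given number of vertices are well-quasi-ordered, so
they contain no infinite antichain. -/
theorem finite_of_isAntichain_of_isLabellable [Finite Γ] (κ : LoopContraction) (t : ℕ) [NeZero t]
    {S : Set (BiasedGraph α β)} (hS : IsAntichain (IsDominated κ) S)
    (h : ∀ Ω ∈ S, V(Ω.graph).ncard = t ∧ Ω.IsLabellable Γ) : S.Finite := by
  by_contra hinf
  have hν : ∀ Ω ∈ S, ∃ ν : α → Fin t, Set.BijOn ν V(Ω.graph) Set.univ := by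
    intro Ω hΩ
    have hcard : V(Ω.graph).encard = (Set.univ : Set (Fin t)).encard := by
      rw [← Ω.finite_vertexSet.cast_ncard_eq, (h Ω hΩ).1]
      simp
    exact Ω.finite_vertexSet.exists_bijOn_of_encard_eq hcard
  choose! ν hν using hν
  choose φ hφ using fun Ω : S => (h Ω Ω.2).2
  have : Infinite S := Set.infinite_coe_iff.2 hinf
  -- Dickson's lemma: finiteness of `Γ` makes the index set of the profiles finite.
  obtain ⟨m, n, hmn, hle⟩ := wellQuasiOrdered_le (α := Fin t × Fin t × Γ → ℕ) fun k =>
    let Ω := Infinite.natEmbedding S k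
    Ω.1.profile (φ Ω) (ν Ω)
  refine hS (Subtype.coe_prop _) (Subtype.coe_prop _) ?_ (isDominated_of_profile_le κ (hφ _)
    (hφ _) (hν _ (Subtype.coe_prop _)) (hν _ (Subtype.coe_prop _)) hle)
  exact fun h => hmn.ne ((Infinite.natEmbedding S).injective (Subtype.ext h))

end BiasedGraph

/-! ### Thick triangles and their balanced cycles -/

namespace Graph

variable {α β : Type*} {G : Graph α β}

lemma IsWalk.right_mem_map_snd {x y : α} {w : List (β × α)} (h : G.IsWalk x w y) (hw : w ≠ []) :
    y ∈ w.map Prod.snd := by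
  induction h with
  | nil => exact (hw rfl).elim
  | @cons e x y z w h hw' ih =>
    rcases w with - | ⟨s, w⟩
    · cases hw'
      simp
    · exact List.mem_cons_of_mem _ (ih (by simp))

lemma IsWalk.exists_isLink_right {x y : α} {w : List (β × α)} (h : G.IsWalk x w y) (hw : w ≠ []) :
    ∃ e z, G.IsLink e z y := by
  induction h with
  | nil => exact (hw rfl).elim
  | @cons e x y z w h hw' ih =>
    rcases w with - | ⟨s, w⟩
    · cases hw'
      exact ⟨e, x, h⟩
    · exact ih (by simp)

/-- A path with at least two edges has an internal vertex. -/
lemma IsPath.exists_mem_walkInterior {x y : α} {w : List (β × α)} (h : G.IsPath x w y)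
    (hw : (walkEdges w).Nontrivial) :
    ∃ e z, G.IsLink e x z ∧ z ∈ walkInterior w ∧ z ≠ x ∧ z ≠ y := by
  obtain ⟨h, hnd⟩ := h
  rcases w with - | ⟨⟨e, z⟩, - | ⟨s, w⟩⟩
  · simp [walkEdges] at hw
  · simp [walkEdges] at hw
  · cases h with
    | cons hl hw' =>
      refine ⟨e, z, hl, by simp [walkInterior], ?_, ?_⟩
      · rintro rfl
        simp at hnd
      · rintro rfl
        have := hw'.right_mem_map_snd (by simp)
        simp only [List.map_cons, List.nodup_cons] at hnd this
        exact hnd.2.1 this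

/-- The graph on the vertex set `W` with edges `ι p` for `p ∈ F`, where `ι (s, i)` joins the
vertices `v s` and `v (s + 1)` of a fixed triangle. -/
def thickTriangle (W : Set α) (v : Fin 3 ↪ α) (hv : ∀ s, v s ∈ W) (ι : Fin 3 × ℕ ↪ β)
    (F : Set (Fin 3 × ℕ)) : Graph α β where
  vertexSet := W
  edgeSet := ι '' F
  IsLink e x y := ∃ p ∈ F, ι p = e ∧
    ((x = v p.1 ∧ y = v (p.1 + 1)) ∨ (x = v (p.1 + 1) ∧ y = v p.1))
  isLink_symm e _ := ⟨fun x y ⟨p, hp, he, h⟩ => ⟨p, hp, he, by tauto⟩⟩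
  eq_or_eq_of_isLink_of_isLink := by
    rintro e x y x' y' ⟨p, -, rfl, h⟩ ⟨q, -, hq, h'⟩
    obtain rfl := ι.injective hq
    rcases h with ⟨rfl, rfl⟩ | ⟨rfl, rfl⟩ <;> rcases h' with ⟨rfl, rfl⟩ | ⟨rfl, rfl⟩ <;> simp
  edge_mem_iff_exists_isLink e := by
    constructor
    · rintro ⟨p, hp, rfl⟩
      exact ⟨_, _, p, hp, rfl, .inl ⟨rfl, rfl⟩⟩
    · rintro ⟨x, y, p, hp, rfl, -⟩
      exact ⟨p, hp, rfl⟩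
  left_mem_of_isLink := by
    rintro e x y ⟨p, -, -, ⟨rfl, -⟩ | ⟨rfl, -⟩⟩ <;> exact hv _

end Graph

section ThickTriangle

open Graph

variable {α β Γ : Type*} [Group Γ] {W : Set α} {v : Fin 3 ↪ α} {hv : ∀ s, v s ∈ W}
  {ι : Fin 3 × ℕ ↪ β} {F : Set (Fin 3 × ℕ)} {l : Fin 3 × ℕ → Γ}

lemma not_isLoopAt_thickTriangle {e : β} {x : α} : ¬ (thickTriangle W v hv ι F).IsLoopAt e x := by
  rintro ⟨p, -, -, ⟨h, h'⟩ | ⟨h, h'⟩⟩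
  · have := v.injective (h.symm.trans h')
    simp at this
  · have := v.injective (h.symm.trans h')
    simp at this

variable (W v hv ι F l) in
/-- The labelling of a thick triangle by `l`, with the triangle oriented cyclically. -/
noncomputable def thickTriangleLabelling : GroupLabelling Γ (thickTriangle W v hv ι F) where
  tail := Function.extend ι (fun p => v p.1) fun _ => v 0
  head := Function.extend ι (fun p => v (p.1 + 1)) fun _ => v 0
  isLink := by
    rintro _ ⟨p, hp, rfl⟩
    exact ⟨p, hp, rfl, .inl ⟨ι.injective.extend_apply .., ι.injective.extend_apply ..⟩⟩
  label := Function.extend ι l 1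

lemma thickTriangleLabelling_tail (p : Fin 3 × ℕ) :
    (thickTriangleLabelling W v hv ι F l).tail (ι p) = v p.1 :=
  ι.injective.extend_apply (fun p => v p.1) (fun _ => v 0) p

lemma thickTriangleLabelling_head (p : Fin 3 × ℕ) :
    (thickTriangleLabelling W v hv ι F l).head (ι p) = v (p.1 + 1) :=
  ι.injective.extend_apply (fun p => v (p.1 + 1)) (fun _ => v 0) p

lemma thickTriangleLabelling_label (p : Fin 3 × ℕ) :
    (thickTriangleLabelling W v hv ι F l).label (ι p) = l p :=
  ι.injective.extend_apply _ _ p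

variable (ι F l) in
/-- The triangles of gain `1` in a thick triangle. -/
def balancedTriangles : Set (Set β) :=
  {C | ∃ i j k, (0, i) ∈ F ∧ (1, j) ∈ F ∧ (2, k) ∈ F ∧ l (0, i) * l (1, j) * l (2, k) = 1 ∧
    C = ι '' {(0, i), (1, j), (2, k)}}

/-- Rotating the starting point of a closed walk conjugates its gain, so having gain `1` does not
depend on the side at which the triangle is entered. -/
lemma mem_balancedTriangles {p q r : Fin 3 × ℕ} (hp : p ∈ F) (hq : q ∈ F) (hr : r ∈ F)
    (hpq : q.1 = p.1 + 1) (hqr : r.1 = q.1 + 1) (h : l p * l q * l r = 1) :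
    ι '' {p, q, r} ∈ balancedTriangles ι F l := by
  obtain ⟨s, i⟩ := p
  obtain ⟨_, j⟩ := q
  obtain ⟨_, k⟩ := r
  simp only at hpq hqr
  subst hpq hqr
  fin_cases s
  · exact ⟨i, j, k, hp, hq, hr, h, rfl⟩
  · refine ⟨k, i, j, hr, hp, hq, ?_, ?_⟩
    · rw [mul_assoc]
      exact mul_eq_one_comm.1 h
    · congr 1
      ext x
      simp only [Set.mem_insert_iff, Set.mem_singleton_iff]
      tauto
  · refine ⟨j, k, i, hq, hr, hp, ?_, ?_⟩
    · exact mul_eq_one_comm.1 (by rwa [← mul_assoc])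
    · congr 1
      ext x
      simp only [Set.mem_insert_iff, Set.mem_singleton_iff]
      tauto

lemma hasGain_thickTriangle_cons {e : β} {x y z : α} {w : List (β × α)} {g : Γ}
    (h : (thickTriangleLabelling W v hv ι F l).HasGain x ((e, y) :: w) z g) :
    ∃ p ∈ F, ι p = e ∧ ∃ g', (thickTriangleLabelling W v hv ι F l).HasGain y w z g' ∧
      ((x = v p.1 ∧ y = v (p.1 + 1) ∧ g = l p * g') ∨
        (x = v (p.1 + 1) ∧ y = v p.1 ∧ g = (l p)⁻¹ * g')) := by
  cases h with
  | forward he hx hy hw =>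
    obtain ⟨p, hp, rfl⟩ := he
    exact ⟨p, hp, rfl, _, hw, .inl ⟨by rw [← hx, thickTriangleLabelling_tail],
      by rw [← hy, thickTriangleLabelling_head], by rw [thickTriangleLabelling_label]⟩⟩
  | backward he hx hy hw =>
    obtain ⟨p, hp, rfl⟩ := he
    exact ⟨p, hp, rfl, _, hw, .inr ⟨by rw [← hx, thickTriangleLabelling_head],
      by rw [← hy, thickTriangleLabelling_tail], by rw [thickTriangleLabelling_label]⟩⟩

lemma hasGain_thickTriangle_nil {x z : α} {g : Γ}
    (h : (thickTriangleLabelling W v hv ι F l).HasGain x [] z g) : x = z ∧ g = 1 := by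
  cases h
  exact ⟨rfl, rfl⟩

lemma exists_walk_of_mem_balancedTriangles {C : Set β} (hC : C ∈ balancedTriangles ι F l) :
    C ∈ (thickTriangleLabelling W v hv ι F l).balancedCycles := by
  obtain ⟨i, j, k, hi, hj, hk, h, rfl⟩ := hC
  have h1 : (thickTriangle W v hv ι F).IsLink (ι (0, i)) (v 0) (v 1) :=
    ⟨_, hi, rfl, .inl ⟨rfl, rfl⟩⟩
  have h2 : (thickTriangle W v hv ι F).IsLink (ι (1, j)) (v 1) (v 2) :=
    ⟨_, hj, rfl, .inl ⟨rfl, rfl⟩⟩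
  have h3 : (thickTriangle W v hv ι F).IsLink (ι (2, k)) (v 2) (v 0) :=
    ⟨_, hk, rfl, .inl ⟨rfl, rfl⟩⟩
  refine ⟨v 0, [(ι (0, i), v 1), (ι (1, j), v 2), (ι (2, k), v 0)],
    ⟨.cons h1 (.cons h2 (.cons h3 (.nil (hv 0)))), by simp, by simp, by simp⟩, ?_, ?_⟩
  · ext e
    simp [walkEdges, eq_comm]
  · have := GroupLabelling.HasGain.forward (φ := thickTriangleLabelling W v hv ι F l) h1.edge_mem
      (thickTriangleLabelling_tail _) (thickTriangleLabelling_head _)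
      (.forward h2.edge_mem (thickTriangleLabelling_tail _) (thickTriangleLabelling_head _)
        (.forward h3.edge_mem (thickTriangleLabelling_tail _) (thickTriangleLabelling_head _)
          (.nil (hv 0))))
    simp only [thickTriangleLabelling_label, mul_one, ← mul_assoc, h] at this
    exact this

/-- The length of a simple closed walk decides the matter. Length 1 would need a loop, and length at
least 4 would need a fourth vertex with edges. In length 2, gain `1` would force equal labels on two
parallel edges. A walk of length 3 runs around the triangle in one of its two directions. -/
lemma balancedCycles_thickTriangle
    (hl : ∀ p ∈ F, ∀ q ∈ F, p.1 = q.1 → l p = l q → p = q) :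
    (thickTriangleLabelling W v hv ι F l).balancedCycles = balancedTriangles ι F l := by
  refine Set.Subset.antisymm ?_ fun C hC => exists_walk_of_mem_balancedTriangles hC
  rintro _ ⟨x, w, ⟨-, hne, hs, he⟩, rfl, hg⟩
  have parity : ∀ s s' : Fin 3, s' = s + 1 → s = s' + 1 → False := by decide
  rcases w with - | ⟨⟨e₁, y₁⟩, w⟩
  · exact (hne rfl).elim
  obtain ⟨p₁, hp₁, rfl, g₁, hg, h₁⟩ := hasGain_thickTriangle_cons hg
  rcases w with - | ⟨⟨e₂, y₂⟩, w⟩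
  · obtain ⟨rfl, -⟩ := hasGain_thickTriangle_nil hg
    rcases h₁ with ⟨h, h', -⟩ | ⟨h, h', -⟩
    · simpa using v.injective (h.symm.trans h')
    · simpa using v.injective (h.symm.trans h')
  obtain ⟨p₂, hp₂, rfl, g₂, hg, h₂⟩ := hasGain_thickTriangle_cons hg
  rcases w with - | ⟨⟨e₃, y₃⟩, w⟩
  · obtain ⟨rfl, rfl⟩ := hasGain_thickTriangle_nil hg
    simp only [List.map_cons, List.map_nil, List.nodup_cons, List.mem_singleton,
      EmbeddingLike.apply_eq_iff_eq] at he
    have key : p₁.1 = p₂.1 → l p₁ = l p₂ → False := fun h h' => he.1 (hl _ hp₁ _ hp₂ h h')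
    rcases h₁ with ⟨a, b, c⟩ | ⟨a, b, c⟩ <;> rcases h₂ with ⟨a', b', c'⟩ | ⟨a', b', c'⟩
    · exact (parity _ _ (v.injective (a'.symm.trans b)) (v.injective (a.symm.trans b'))).elim
    · refine (key (v.injective (a.symm.trans b')) ?_).elim
      rw [c', mul_one] at c
      exact mul_inv_eq_one.1 c.symm
    · refine (key (v.injective (b.symm.trans a')) ?_).elim
      rw [c', mul_one] at c
      exact inv_mul_eq_one.1 c.symm
    · exact (parity _ _ (v.injective (a.symm.trans b').symm) (v.injective (a'.symm.trans b).symm)).elim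
  obtain ⟨p₃, hp₃, rfl, g₃, hg, h₃⟩ := hasGain_thickTriangle_cons hg
  rcases w with - | ⟨⟨e₄, y₄⟩, w⟩
  · obtain ⟨rfl, rfl⟩ := hasGain_thickTriangle_nil hg
    have r₁ : ∃ s, y₁ = v s := by rcases h₁ with ⟨-, h, -⟩ | ⟨-, h, -⟩ <;> exact ⟨_, h⟩
    have r₂ : ∃ s, y₂ = v s := by rcases h₂ with ⟨-, h, -⟩ | ⟨-, h, -⟩ <;> exact ⟨_, h⟩
    have r₃ : ∃ s, y₃ = v s := by rcases h₃ with ⟨-, h, -⟩ | ⟨-, h, -⟩ <;> exact ⟨_, h⟩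
    obtain ⟨s₁, rfl⟩ := r₁
    obtain ⟨s₂, rfl⟩ := r₂
    obtain ⟨s₃, rfl⟩ := r₃
    simp only [List.map_cons, List.map_nil, List.nodup_cons, List.mem_cons, List.not_mem_nil,
      or_false, not_or, EmbeddingLike.apply_eq_iff_eq] at hs h₁ h₂ h₃
    have hset : walkEdges [(ι p₁, v s₁), (ι p₂, v s₂), (ι p₃, v s₃)] = ι '' {p₁, p₂, p₃} := by
      ext e
      simp [walkEdges, eq_comm]
    have hset' : ({p₁, p₂, p₃} : Set (Fin 3 × ℕ)) = {p₃, p₂, p₁} := by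
      rw [Set.insert_comm p₁, Set.pair_comm p₁, Set.insert_comm p₂]
    have cyclic : ∀ s₁ s₂ s₃ : Fin 3, s₁ ≠ s₂ → s₁ ≠ s₃ → s₂ ≠ s₃ →
        (s₁ = s₃ + 1 ∧ s₂ = s₁ + 1 ∧ s₃ = s₂ + 1) ∨
        (s₃ = s₁ + 1 ∧ s₁ = s₂ + 1 ∧ s₂ = s₃ + 1) := by omega
    rw [hset]
    rcases cyclic s₁ s₂ s₃ hs.1.1 hs.1.2 hs.2.1 with ⟨c₁, c₂, c₃⟩ | ⟨c₁, c₂, c₃⟩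
    · have d₁ := h₁.resolve_right fun h => parity _ _ c₁ (by rw [h.1, h.2.1])
      have d₂ := h₂.resolve_right fun h => parity _ _ c₂ (by rw [h.1, h.2.1])
      have d₃ := h₃.resolve_right fun h => parity _ _ c₃ (by rw [h.1, h.2.1])
      refine mem_balancedTriangles hp₁ hp₂ hp₃ (d₂.1.symm.trans d₁.2.1) (d₃.1.symm.trans d₂.2.1) ?_
      rw [d₁.2.2, d₂.2.2, d₃.2.2, mul_one, mul_assoc]
    -- Against the orientation, the gain of the walk is the inverse of the gain of the reversed
    -- triangle.
    · have d₁ := h₁.resolve_left fun h => parity _ _ c₁ (by rw [h.1, h.2.1])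
      have d₂ := h₂.resolve_left fun h => parity _ _ c₂ (by rw [h.1, h.2.1])
      have d₃ := h₃.resolve_left fun h => parity _ _ c₃ (by rw [h.1, h.2.1])
      rw [hset']
      refine mem_balancedTriangles hp₃ hp₂ hp₁ (d₂.2.1.symm.trans d₃.1) (d₁.2.1.symm.trans d₂.1) ?_
      have := d₁.2.2
      rw [d₂.2.2, d₃.2.2, mul_one] at this
      rw [← inv_eq_one, mul_inv_rev, mul_inv_rev]
      exact this.symm
  · exfalso
    obtain ⟨p₄, hp₄, rfl, g₄, hg, h₄⟩ := hasGain_thickTriangle_cons hg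
    have r₁ : ∃ s, y₁ = v s := by rcases h₁ with ⟨-, h, -⟩ | ⟨-, h, -⟩ <;> exact ⟨_, h⟩
    have r₂ : ∃ s, y₂ = v s := by rcases h₂ with ⟨-, h, -⟩ | ⟨-, h, -⟩ <;> exact ⟨_, h⟩
    have r₃ : ∃ s, y₃ = v s := by rcases h₃ with ⟨-, h, -⟩ | ⟨-, h, -⟩ <;> exact ⟨_, h⟩
    have r₄ : ∃ s, y₄ = v s := by rcases h₄ with ⟨-, h, -⟩ | ⟨-, h, -⟩ <;> exact ⟨_, h⟩
    obtain ⟨s₁, rfl⟩ := r₁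
    obtain ⟨s₂, rfl⟩ := r₂
    obtain ⟨s₃, rfl⟩ := r₃
    obtain ⟨s₄, rfl⟩ := r₄
    simp only [List.map_cons, List.nodup_cons, List.mem_cons, not_or,
      EmbeddingLike.apply_eq_iff_eq] at hs
    omega

/-- A balanced triangle is determined by any two of its edges, so a theta whose first two paths and
whose last two paths form balanced triangles has two paths with an internal vertex, which are
not disjoint. -/
lemma not_isTheta_thickTriangle (hl : ∀ p ∈ F, ∀ q ∈ F, p.1 = q.1 → l p = l q → p = q)
    {A B C : Set β} (h : (thickTriangle W v hv ι F).IsTheta A B C)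
    (hAB : A ∪ B ∈ balancedTriangles ι F l) (hBC : B ∪ C ∈ balancedTriangles ι F l) : False := by
  obtain ⟨x, y, p, q, r, hxy, hp, hq, hr, -, -, hpr, rfl, rfl, rfl, dAB, dBC, dAC⟩ := h
  obtain ⟨i, j, k, hi, hj, hk, hg, hT⟩ := hAB
  obtain ⟨i', j', k', hi', hj', hk', hg', hT'⟩ := hBC
  have inA : ∀ e, e ∈ ι '' {(0, i), (1, j), (2, k)} → e ∉ ι '' {(0, i'), (1, j'), (2, k')} →
      e ∈ walkEdges p := by
    intro e h1 h2
    rw [← hT] at h1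
    rw [← hT'] at h2
    exact h1.resolve_right fun h => h2 (.inl h)
  have inC : ∀ e, e ∈ ι '' {(0, i'), (1, j'), (2, k')} → e ∉ ι '' {(0, i), (1, j), (2, k)} →
      e ∈ walkEdges r := by
    intro e h1 h2
    rw [← hT'] at h1
    rw [← hT] at h2
    exact h1.resolve_left fun h => h2 (.inr h)
  have mem_range : ∀ {e z z'}, (thickTriangle W v hv ι F).IsLink e z z' → ∃ s, z = v s := by
    rintro e z z' ⟨p, -, -, ⟨h, -⟩ | ⟨h, -⟩⟩ <;> exact ⟨_, h⟩
  have key : ∀ (s s' : Fin 3) (a b a' b' : ℕ), s ≠ s' →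
      ι (s, a) ∈ walkEdges p → ι (s', b) ∈ walkEdges p →
      ι (s, a') ∈ walkEdges r → ι (s', b') ∈ walkEdges r → False := by
    intro s s' a b a' b' hs h1 h2 h3 h4
    obtain ⟨e, z, hz, hzp, hzx, hzy⟩ := hp.exists_mem_walkInterior
      ⟨_, h1, _, h2, fun h => hs (congrArg Prod.fst (ι.injective h))⟩
    obtain ⟨e', z', hz', hzr, hzx', hzy'⟩ := hr.exists_mem_walkInterior
      ⟨_, h3, _, h4, fun h => hs (congrArg Prod.fst (ι.injective h))⟩
    obtain ⟨a, rfl⟩ := mem_range hz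
    obtain ⟨b, rfl⟩ := mem_range hz.symm
    obtain ⟨c, rfl⟩ := mem_range hz'.symm
    obtain ⟨d, rfl⟩ : ∃ s, y = v s := by
      obtain ⟨e, z, h⟩ := hp.1.exists_isLink_right (by rintro rfl; simp [walkEdges] at h1)
      exact mem_range h.symm
    refine hpr hzp ?_
    -- The triangle has only one vertex besides the ends `x` and `y`.
    have : b = c := by
      simp only [ne_eq, EmbeddingLike.apply_eq_iff_eq] at hxy hzx hzy hzx' hzy'
      omega
    rwa [this]
  have hsame : ¬ (i = i' ∧ j = j' ∧ k = k') := by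
    rintro ⟨rfl, rfl, rfl⟩
    rcases p with - | ⟨s, p⟩
    · cases hp.1
      exact hxy rfl
    · have hs : s.1 ∈ walkEdges (s :: p) := by simp [walkEdges]
      have : s.1 ∈ walkEdges q ∪ walkEdges r := by
        rw [hT', ← hT]
        exact .inl hs
      rcases this with h | h
      · exact Set.disjoint_left.1 dAB hs h
      · exact Set.disjoint_left.1 dAC hs h
  -- Distinct balanced triangles share at most one edge: two common labels determine the third by
  -- cancellation, and parallel edges have distinct labels.
  have hij : i = i' → j ≠ j' := by
    rintro rfl rfl
    have := hl _ hk _ hk' rfl (mul_left_cancel (hg.trans hg'.symm))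
    exact hsame ⟨rfl, rfl, by simpa using this⟩
  have hik : i = i' → k ≠ k' := by
    rintro rfl rfl
    have := hl _ hj _ hj' rfl (mul_left_cancel (mul_right_cancel (hg.trans hg'.symm)))
    exact hsame ⟨rfl, by simpa using this, rfl⟩
  have hjk : j = j' → k ≠ k' := by
    rintro rfl rfl
    have := hl _ hi _ hi' rfl (mul_right_cancel (mul_right_cancel (hg.trans hg'.symm)))
    exact hsame ⟨by simpa using this, rfl, rfl⟩
  by_cases h1 : i = i'
  · have h2 := hij h1
    have h3 := hik h1
    refine key 1 2 j k j' k' (by decide) (inA _ ?_ ?_) (inA _ ?_ ?_) (inC _ ?_ ?_) (inC _ ?_ ?_) <;>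
      simp [h2, h3, h2.symm, h3.symm]
  by_cases h2 : j = j'
  · have h3 := hjk h2
    refine key 0 2 i k i' k' (by decide) (inA _ ?_ ?_) (inA _ ?_ ?_) (inC _ ?_ ?_) (inC _ ?_ ?_) <;>
      simp [h1, h3, Ne.symm h1, h3.symm]
  · refine key 0 1 i j i' j' (by decide) (inA _ ?_ ?_) (inA _ ?_ ?_) (inC _ ?_ ?_) (inC _ ?_ ?_) <;>
      simp [h1, h2, Ne.symm h1, Ne.symm h2]

/-- The biased graph of a thick triangle in which parallel edges have distinct labels. -/
def biasedThickTriangle (hW : W.Finite) (hF : F.Finite) (hv : ∀ s, v s ∈ W)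
    (hl : ∀ p ∈ F, ∀ q ∈ F, p.1 = q.1 → l p = l q → p = q) : BiasedGraph α β where
  graph := thickTriangle W v hv ι F
  finite_vertexSet := hW
  finite_edgeSet := hF.image ι
  balanced := balancedTriangles ι F l
  isCycle_of_balanced C hC := by
    obtain ⟨x, w, h1, h2, -⟩ := exists_walk_of_mem_balancedTriangles (hv := hv) hC
    exact ⟨x, w, h1, h2⟩
  theta A B C h hAB hBC := (not_isTheta_thickTriangle hl h hAB hBC).elim

end ThickTriangle

/-! ### Minors that keep every vertex -/

namespace BiasedGraph

variable {α β : Type*}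

lemma isDominated_refl (κ : LoopContraction) (Ω : BiasedGraph α β) : Ω.IsDominated κ Ω :=
  ⟨Ω, Relation.ReflTransGen.refl, id, id, Set.bijOn_id _, Set.bijOn_id _, by simp, by simp⟩

lemma ncard_vertexSet_contractLink_lt {G : Graph α β} (hG : V(G).Finite) {e : β} {x y : α}
    (h : G.IsLink e x y) (hxy : x ≠ y) : V(G.contractLink e x y).ncard < V(G).ncard := by
  refine Set.ncard_lt_ncard ?_ hG
  refine Set.ssubset_iff_exists.2 ⟨?_, y, h.right_mem, ?_⟩
  · rintro _ ⟨v, hv, rfl⟩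
    dsimp only
    split_ifs
    · exact h.left_mem
    · exact hv
  · rintro ⟨v, hv, hvy⟩
    dsimp only at hvy
    split_ifs at hvy with hv'
    · exact hxy hvy
    · exact hv' hvy

/-- No minor has more vertices, and a minor of a loopless biased graph with the same number of
vertices is formed by deletions only. -/
lemma IsMinor.balanced_subset {κ : LoopContraction} {Ω Ω' : BiasedGraph α β} (h : IsMinor κ Ω' Ω)
    (hloop : ∀ e x, ¬ Ω.graph.IsLoopAt e x) (hcard : V(Ω'.graph).ncard = V(Ω.graph).ncard) :
    Ω'.balanced ⊆ Ω.balanced := by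
  -- Looplessness belongs to the invariant: as long as no vertex is lost it survives deletions, and
  -- it rules out contracting an unbalanced loop.
  suffices H : V(Ω'.graph).ncard < V(Ω.graph).ncard ∨ V(Ω'.graph) = V(Ω.graph) ∧
      (∀ e x, ¬ Ω'.graph.IsLoopAt e x) ∧ Ω'.balanced ⊆ Ω.balanced from
    (H.resolve_left hcard.not_lt).2.2
  clear hcard
  induction h with
  | refl => exact .inr ⟨rfl, hloop, subset_rfl⟩
  | @tail Θ Θ' _ hstep ih =>
    have hdel : ∀ e, Θ.IsDeletion e Θ' → V(Θ'.graph).ncard < V(Ω.graph).ncard ∨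
        V(Θ'.graph) = V(Ω.graph) ∧ (∀ e x, ¬ Θ'.graph.IsLoopAt e x) ∧
        Θ'.balanced ⊆ Ω.balanced := by
      rintro e ⟨h1, h2⟩
      refine ih.imp (fun h => by rwa [h1]) fun ⟨h3, h4, h5⟩ => ⟨by rw [← h3, h1]; rfl, ?_, ?_⟩
      · rintro f x hf
        rw [h1] at hf
        exact h4 f x hf.1
      · rw [h2]
        exact fun C hC => h5 hC.1
    rcases hstep with ⟨e, -, h⟩ | ⟨e, -, h⟩ | ⟨e, x, y, he, hxy, h⟩ | ⟨-, e, x, he, -, h⟩ |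
      ⟨-, e, x, he, -, h⟩
    · exact hdel e h
    · exact hdel e h
    · left
      rw [h.1]
      refine (ncard_vertexSet_contractLink_lt Θ.finite_vertexSet he hxy).trans_le ?_
      rcases ih with h | h
      · exact h.le
      · rw [h.1]
    · refine ih.imp (fun h' => by rwa [h.1]) fun h' => (h'.2.1 e x he).elim
    · refine ih.imp (fun h' => by rwa [h.1]) fun h' => (h'.2.1 e x he).elim

end BiasedGraph

/-! ### Rings of triangles and labels realizing them -/

/-- An injective map between cycles of lengths `M` and `N` that preserves adjacency is onto. -/
lemma le_of_cycle_embedding {M N : ℕ} (hM : 3 ≤ M) {σ : ℕ → ℕ} (hσ : ∀ k < M, σ k < N)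
    (hinj : ∀ k < M, ∀ k' < M, σ k = σ k' → k = k')
    (hadj : ∀ k < M, σ ((k + 1) % M) = (σ k + 1) % N ∨ σ k = (σ ((k + 1) % M) + 1) % N) :
    N ≤ M := by
  have succ_inj : ∀ a < N, ∀ b < N, (a + 1) % N = (b + 1) % N → a = b := by
    intro a ha b hb h
    have : a + 1 ≡ b + 1 [MOD N] := h
    exact (Nat.ModEq.add_right_cancel' 1 this).eq_of_lt_of_lt ha hb
  -- The image is closed under successor. The two neighbours of `k` are distinct since `3 ≤ M`, so
  -- by injectivity they cannot both go to the predecessor of `σ k`.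
  have closed : ∀ k < M, ∃ k' < M, σ k' = (σ k + 1) % N := by
    intro k hk
    have hM0 : 0 < M := by omega
    rcases hadj k hk with h | h
    · exact ⟨_, Nat.mod_lt _ hM0, h⟩
    obtain ⟨k', hk', hkk', hne⟩ : ∃ k' < M, (k' + 1) % M = k ∧ k' ≠ (k + 1) % M := by
      rcases Nat.eq_zero_or_pos k with rfl | hpos
      · refine ⟨M - 1, by omega, ?_, ?_⟩
        · rw [Nat.sub_add_cancel (by omega), Nat.mod_self]
        · rw [Nat.mod_eq_of_lt (by omega)]
          omega
      · refine ⟨k - 1, by omega, ?_, ?_⟩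
        · rw [Nat.sub_add_cancel hpos, Nat.mod_eq_of_lt hk]
        · rcases Nat.lt_or_ge (k + 1) M with h | h
          · rw [Nat.mod_eq_of_lt h]
            omega
          · rw [show k + 1 = M by omega, Nat.mod_self]
            omega
    rcases hadj k' hk' with h' | h'
    · rw [hkk', h] at h'
      have := succ_inj _ (hσ _ (Nat.mod_lt _ hM0)) _ (hσ _ hk') h'
      exact (hne (hinj _ (Nat.mod_lt _ hM0) _ hk' this).symm).elim
    · rw [hkk'] at h'
      exact ⟨k', hk', h'⟩
  have all : ∀ d, ∃ k < M, σ k = (σ 0 + d) % N := by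
    intro d
    induction d with
    | zero => exact ⟨0, by omega, (Nat.mod_eq_of_lt (hσ 0 (by omega))).symm⟩
    | succ d ih =>
      obtain ⟨k, hk, h⟩ := ih
      obtain ⟨k', hk', h'⟩ := closed k hk
      refine ⟨k', hk', h'.trans ?_⟩
      rw [h, Nat.mod_add_mod, add_assoc]
  have hsub : Finset.range N ⊆ (Finset.range M).image σ := by
    intro j hj
    rw [Finset.mem_range] at hj
    -- This number of successor steps leads from `σ 0` to `j + N`, which is `j` modulo `N`.
    obtain ⟨k, hk, h⟩ := all (j + (N - σ 0))
    have h0 := hσ 0 (by omega)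
    rw [show σ 0 + (j + (N - σ 0)) = j + N by omega, Nat.add_mod_right, Nat.mod_eq_of_lt hj] at h
    exact Finset.mem_image.2 ⟨k, Finset.mem_range.2 hk, h⟩
  simpa using (Finset.card_le_card hsub).trans Finset.card_image_le

/-- The `k`-th triangle in a cyclic sequence of `2 * n` triangles in which consecutive ones share
an edge. -/
def cyclicTriangle (n k : ℕ) : Set (Fin 3 × ℕ) :=
  {(0, k / 2), (1, (k + 1) / 2 % n), (2, k)}

lemma half_succ_mod {n k : ℕ} (hk : k < 2 * n) :
    (k + 1) / 2 % n = if k + 1 = 2 * n then 0 else (k + 1) / 2 := by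
  split_ifs with h
  · rw [h]
    simp
  · exact Nat.mod_eq_of_lt (by omega)

lemma succ_mod_two_mul {n k : ℕ} (hk : k < 2 * n) :
    (k + 1) % (2 * n) = if k + 1 = 2 * n then 0 else k + 1 := by
  split_ifs with h
  · rw [h]
    simp
  · exact Nat.mod_eq_of_lt (by omega)

/-- An even `k` shares its edge on side 0 with the next triangle, an odd `k` its edge on side 1. The
reduction modulo `n` makes the last triangle meet the first. -/
lemma cyclicTriangle_inter_succ {n k : ℕ} (hk : k < 2 * n) :
    (cyclicTriangle n k ∩ cyclicTriangle n ((k + 1) % (2 * n))).Nonempty := by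
  have hk' := Nat.mod_lt (k + 1) (show 0 < 2 * n by omega)
  rcases Nat.even_or_odd' k with ⟨i, rfl | rfl⟩
  · refine ⟨(0, i), by simp [cyclicTriangle], ?_⟩
    rw [succ_mod_two_mul hk, if_neg (by omega)]
    left
    simp only [Prod.mk.injEq, true_and]
    omega
  · refine ⟨(1, (2 * i + 1 + 1) / 2 % n), by simp [cyclicTriangle], .inr (.inl ?_)⟩
    simp only [Prod.mk.injEq, true_and]
    rw [half_succ_mod hk, half_succ_mod hk', succ_mod_two_mul hk]
    split_ifs <;> omega

/-- On side 0, edge `i` lies only in triangles `2 * i` and `2 * i + 1`; on side 1, edge `j` lies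
only in triangles `2 * j - 1` and `2 * j`, cyclically; each edge of side 2 lies in a single
triangle. -/
lemma eq_or_eq_of_cyclicTriangle_inter {n k k' : ℕ} (hk : k < 2 * n) (hk' : k' < 2 * n)
    (hne : k ≠ k') (h : (cyclicTriangle n k ∩ cyclicTriangle n k').Nonempty) :
    k' = (k + 1) % (2 * n) ∨ k = (k' + 1) % (2 * n) := by
  obtain ⟨⟨s, i⟩, h1, h2⟩ := h
  simp only [cyclicTriangle, Set.mem_insert_iff, Set.mem_singleton_iff, Prod.mk.injEq,
    half_succ_mod hk, half_succ_mod hk'] at h1 h2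
  rw [succ_mod_two_mul hk, succ_mod_two_mul hk']
  split_ifs at * <;> omega

/-- This makes the labels on side 2 distinct. It fails for `n = 1`, where both triangles would use
the same edges on sides 0 and 1. -/
lemma eq_of_half_eq {n k k' : ℕ} (hn : 2 ≤ n) (hk : k < 2 * n) (hk' : k' < 2 * n)
    (h : k / 2 = k' / 2) (h' : (k + 1) / 2 % n = (k' + 1) / 2 % n) : k = k' := by
  rw [half_succ_mod hk, half_succ_mod hk'] at h'
  split_ifs at h' <;> omega

/-- In an infinite group there are sequences whose first `n` and `n` terms have distinct
products. -/
lemma exists_products_injective {Γ : Type*} [Group Γ] [Infinite Γ] (n : ℕ) :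
    ∃ a b : ℕ → Γ, ∀ i < n, ∀ j, ∀ i' < n, ∀ j', a i * b j = a i' * b j' → i = i' ∧ j = j' := by
  classical
  let a := Infinite.natEmbedding Γ
  obtain ⟨b, -, hb⟩ := exists_seq_of_forall_finset_exists (fun _ : Γ => True)
    (fun x y => ∀ i < n, ∀ i' < n, a i * x ≠ a i' * y) fun s _ => by
      obtain ⟨y, hy⟩ := Infinite.exists_notMem_finset
        -- Each new term of `b` has only finitely many forbidden values, namely those at which some
        -- `a i' * y` equals a product `a i * x` with an earlier `x`.
        ((s ×ˢ Finset.range n ×ˢ Finset.range n).image fun p => (a p.2.2)⁻¹ * (a p.2.1 * p.1))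
      refine ⟨y, trivial, fun x hx i hi i' hi' h => hy ?_⟩
      refine Finset.mem_image.2 ⟨(x, i, i'), by simp [hx, hi, hi'], ?_⟩
      simp [h]
  refine ⟨a, b, fun i hi j i' hi' j' h => ?_⟩
  have hj : j = j' := by
    rcases lt_trichotomy j j' with hlt | rfl | hlt
    · exact (hb _ _ hlt i hi i' hi' h).elim
    · rfl
    · exact (hb _ _ hlt i' hi' i hi h.symm).elim
  subst hj
  exact ⟨a.injective (mul_right_cancel h), rfl⟩

/-- A labelled biased graph whose balanced cycles are a cyclic sequence of `2 * n` triangles. -/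
lemma exists_biasedGraph_cyclicTriangles {α β Γ : Type*} [Group Γ] [Infinite Γ] {W : Set α}
    (hW : W.Finite) (v : Fin 3 ↪ α) (hv : ∀ s, v s ∈ W) (ι : Fin 3 × ℕ ↪ β) {n : ℕ} (hn : 2 ≤ n) :
    ∃ Ω : BiasedGraph α β, V(Ω.graph) = W ∧ Ω.IsLabellable Γ ∧
      (∀ e x, ¬ Ω.graph.IsLoopAt e x) ∧
      Ω.balanced = {C | ∃ k < 2 * n, C = ι '' cyclicTriangle n k} ∧
      ∀ k < 2 * n, ι '' cyclicTriangle n k ⊆ E(Ω.graph) := by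
  obtain ⟨a, b, hab⟩ := exists_products_injective (Γ := Γ) n
  let F : Set (Fin 3 × ℕ) := {p | p.2 < if p.1 = 2 then 2 * n else n}
  have hF : F.Finite := by
    refine (Set.finite_univ.prod (Set.finite_Iio (2 * n))).subset fun p hp => ⟨trivial, ?_⟩
    have : p.2 < if p.1 = 2 then 2 * n else n := hp
    rw [Set.mem_Iio]
    split_ifs at this <;> omega
  have hF0 : ∀ i, (0, i) ∈ F ↔ i < n := fun i => by simp [F]
  have hF1 : ∀ i, (1, i) ∈ F ↔ i < n := fun i => by simp [F]
  have hF2 : ∀ i, (2, i) ∈ F ↔ i < 2 * n := fun i => by simp [F]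
  let l : Fin 3 × ℕ → Γ := fun p =>
    ![a p.2, b p.2, (a (p.2 / 2) * b ((p.2 + 1) / 2 % n))⁻¹] p.1
  have hl : ∀ p ∈ F, ∀ q ∈ F, p.1 = q.1 → l p = l q → p = q := by
    rintro ⟨s, i⟩ hi ⟨_, j⟩ hj rfl h
    fin_cases s
    · have h' : a i = a j := h
      rw [(hab i ((hF0 i).1 hi) 0 j ((hF0 j).1 hj) 0 (by rw [h'])).1]
    · have h' : b i = b j := h
      rw [(hab 0 (by omega) i 0 (by omega) j (by rw [h'])).2]
    · have h' : (a (i / 2) * b ((i + 1) / 2 % n))⁻¹ = (a (j / 2) * b ((j + 1) / 2 % n))⁻¹ := h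
      have hi' := (hF2 i).1 hi
      have hj' := (hF2 j).1 hj
      obtain ⟨h1, h2⟩ := hab _ (by omega) _ _ (by omega) _ (inv_injective h')
      rw [eq_of_half_eq hn hi' hj' h1 h2]
  have hmem : ∀ k < 2 * n, cyclicTriangle n k ⊆ F := by
    rintro k hk p (rfl | rfl | rfl)
    · exact (hF0 _).2 (by omega)
    · exact (hF1 _).2 (Nat.mod_lt _ (by omega))
    · exact (hF2 _).2 hk
  refine ⟨biasedThickTriangle (ι := ι) hW hF hv hl, rfl,
    ⟨thickTriangleLabelling W v hv ι F l, balancedCycles_thickTriangle hl⟩,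
    fun e x => not_isLoopAt_thickTriangle (hv := hv), ?_, fun k hk => Set.image_mono (hmem k hk)⟩
  ext C
  constructor
  · rintro ⟨i, j, k, hi, hj, hk, h, rfl⟩
    have hk' := (hF2 k).1 hk
    have h' : a i * b j * (a (k / 2) * b ((k + 1) / 2 % n))⁻¹ = 1 := h
    -- The edge on side 2 prescribes the product of the other two labels, and hence the other two
    -- edges.
    obtain ⟨rfl, rfl⟩ := hab _ ((hF0 i).1 hi) _ _ (by omega) _ (mul_inv_eq_one.1 h')
    exact ⟨k, hk', rfl⟩
  · rintro ⟨k, hk, rfl⟩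
    refine ⟨k / 2, (k + 1) / 2 % n, k, hmem k hk (by simp [cyclicTriangle]),
      hmem k hk (by simp [cyclicTriangle]), hmem k hk (by simp [cyclicTriangle]), ?_, rfl⟩
    exact mul_inv_cancel (a (k / 2) * b ((k + 1) / 2 % n))

/-- The induced map on positions is injective because the edge `(2, k)` belongs to triangle `k`
alone, and it preserves adjacency because images of intersecting triangles intersect. The cycle
embedding gives `n ≤ m`, and counting gives `m ≤ n`. -/
lemma le_of_cyclicTriangle_embedding {β : Type*} {ι : Fin 3 × ℕ ↪ β} {m n : ℕ} (hm : 2 ≤ m)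
    {g : β → β} {T : Set β} (hg : Set.InjOn g T) (hT : ∀ k < 2 * m, ι '' cyclicTriangle m k ⊆ T)
    (h : ∀ k < 2 * m, ∃ k' < 2 * n, g '' (ι '' cyclicTriangle m k) = ι '' cyclicTriangle n k') :
    m = n := by
  choose! σ hσ hσg using h
  have hinj : ∀ k < 2 * m, ∀ k' < 2 * m, σ k = σ k' → k = k' := by
    intro k hk k' hk' hkk'
    have h1 : g '' (ι '' cyclicTriangle m k) = g '' (ι '' cyclicTriangle m k') := by
      rw [hσg k hk, hσg k' hk', hkk']
    have h2 := ι.injective.image_injective ((hg.image_eq_image_iff (hT k hk) (hT k' hk')).1 h1)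
    have h3 : ((2, k) : Fin 3 × ℕ) ∈ cyclicTriangle m k' := by
      rw [← h2]
      simp [cyclicTriangle]
    simpa [cyclicTriangle] using h3
  have hle : 2 * n ≤ 2 * m := by
    refine le_of_cycle_embedding (by omega) hσ hinj fun k hk => ?_
    have hk' := Nat.mod_lt (k + 1) (show 0 < 2 * m by omega)
    refine eq_or_eq_of_cyclicTriangle_inter (hσ k hk) (hσ _ hk') (fun h => ?_) ?_
    · have := hinj _ hk _ hk' h
      rw [succ_mod_two_mul hk] at this
      split_ifs at this <;> omega
    · obtain ⟨p, hp, hp'⟩ := cyclicTriangle_inter_succ hk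
      have h1 : g (ι p) ∈ ι '' cyclicTriangle n (σ k) := hσg k hk ▸ ⟨_, ⟨p, hp, rfl⟩, rfl⟩
      have h2 : g (ι p) ∈ ι '' cyclicTriangle n (σ ((k + 1) % (2 * m))) :=
        hσg _ hk' ▸ ⟨_, ⟨p, hp', rfl⟩, rfl⟩
      obtain ⟨q, hq, hqp⟩ := h1
      obtain ⟨q', hq', hqp'⟩ := h2
      obtain rfl := ι.injective (hqp.trans hqp'.symm)
      exact ⟨q, hq, hq'⟩
  have hge : 2 * m ≤ 2 * n := by
    have := Finset.card_le_card_of_injOn (s := Finset.range (2 * m)) (t := Finset.range (2 * n)) σ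
      (fun k hk => Finset.mem_coe.2 (Finset.mem_range.2 (hσ k (Finset.mem_range.1 hk))))
      (fun k hk k' hk' h => hinj k (by simpa using hk) k' (by simpa using hk') h)
    simpa using this
  omega

/-! ### The antichain and the equivalence -/

theorem exists_infinite_antichain {Γ α β : Type*} [Group Γ] [Infinite α] [Infinite β] [Infinite Γ]
    (κ : LoopContraction) (t : ℕ) (ht : 3 ≤ t) :
    ∃ S : Set (BiasedGraph α β), S.Infinite ∧ IsAntichain (BiasedGraph.IsDominated κ) S ∧
      ∀ Ω ∈ S, V(Ω.graph).ncard = t ∧ Ω.IsLabellable Γ := by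
  let u := Infinite.natEmbedding α
  let W : Set α := u '' Set.Iio t
  have hWt : W.ncard = t := by
    rw [Set.ncard_image_of_injective _ u.injective]
    simp
  let v : Fin 3 ↪ α := Fin.valEmbedding.trans u
  have hv : ∀ s, v s ∈ W := fun s => ⟨s, lt_of_lt_of_le s.2 ht, rfl⟩
  let ι : Fin 3 × ℕ ↪ β := 
    (⟨Encodable.encode, Encodable.encode_injective⟩ : Fin 3 × ℕ ↪ ℕ).trans (Infinite.natEmbedding β)
  -- The graph with index `n` carries a ring of `2 * (n + 2)` triangles, the shift ensuring the
  -- required bound `2 ≤ n + 2`.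
  choose Ω hV hlab hloop hbal hE using fun n : ℕ => exists_biasedGraph_cyclicTriangles (Γ := Γ)
    ((Set.finite_Iio t).image u) v hv ι (Nat.le_add_left 2 n)
  have key : ∀ m n, (Ω m).IsDominated κ (Ω n) → m = n := by
    rintro m n ⟨Ω', hminor, f, g, hf, hg, -, hb⟩
    have hcard : V(Ω'.graph).ncard = V((Ω n).graph).ncard := by
      rw [← hf.image_eq, hf.injOn.ncard_image, hV, hV]
    -- Both graphs have vertex set `W`, so the minor keeps the number of vertices and the image of
    -- each balanced triangle of `Ω m` is already balanced in `Ω n`.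
    have hsub := hminor.balanced_subset (hloop n) hcard
    have := le_of_cyclicTriangle_embedding (Nat.le_add_left 2 m) hg.injOn (hE m) (n := n + 2)
      fun k hk => by
        have h1 : ι '' cyclicTriangle (m + 2) k ∈ (Ω m).balanced := by
          rw [hbal]
          exact ⟨k, hk, rfl⟩
        have h2 := hsub ((hb _ (hE m k hk)).1 h1)
        rwa [hbal] at h2
    omega
  have hinj : Function.Injective Ω := fun m n h =>
    key m n (h ▸ BiasedGraph.isDominated_refl κ (Ω m))
  refine ⟨Set.range Ω, Set.infinite_range_of_injective hinj, ?_, ?_⟩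
  · rintro _ ⟨m, rfl⟩ _ ⟨n, rfl⟩ hne h
    exact hne (congrArg Ω (key m n h))
  · rintro _ ⟨n, rfl⟩
    exact ⟨by rw [hV, hWt], hlab n⟩

/-- The vertex and edge types are only required to be infinite, so that every finite graph has
an isomorphic copy with its vertices in `α` and its edges in `β`. -/
theorem theorem1p5 {Γ α β : Type*} [Group Γ] [Infinite α] [Infinite β] (κ : LoopContraction)
    (t : ℕ) (ht : 3 ≤ t) :
    (∃ S : Set (BiasedGraph α β), S.Infinite ∧ IsAntichain (BiasedGraph.IsDominated κ) S ∧
      ∀ Ω ∈ S, V(Ω.graph).ncard = t ∧ Ω.IsLabellable Γ) ↔ Infinite Γ := by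
  refine ⟨fun ⟨S, hS, hanti, h⟩ => ?_, fun _ => exists_infinite_antichain κ t ht⟩
  by_contra hΓ
  have : Finite Γ := not_infinite_iff_finite.1 hΓ
  have : NeZero t := ⟨by omega⟩
  exact hS (BiasedGraph.finite_of_isAntichain_of_isLabellable (Γ := Γ) κ t hanti h)
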